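/- Let $0<p<1$, let $M\in\mathbf R^{n\times n}$ be a deterministic matrix, and let $C$ be a symmetric random $n\times n$ matrix whose entries $C_{ij}$, $i\ge j$, are independent and satisfy $$C_{ij}=\sqrt{\tfrac{1-p}{p}}\ \text{ with probability } p,\qquad C_{ij}=-\sqrt{\tfrac{p}{1-p}}\ \text{ with probability } 1-p .$$ Put $E=r_p\,M\circ C$, where $r_p=\sqrt{(1-p)/p}$ and $\circ$ is the entrywise (Hadamard) product. Write $\|\cdot\|_2$ for the spectral norm and $\|M\|_\infty=\max_{i,j}|M_{ij}|$, and let $m_E$ be any median of $\|E\|_2$. Then, for every $t\ge 0$, $$P\big(\big|\|E\|_2-m_E\big|>t\big)\le 4\exp\Big(-\frac{p^2}{8\|M\|_\infty^2}\,t^2\Big)$$ (for $M=0$ the exponent is not defined; this case is trivial, since then $E=0$ and $m_E=0$). Moreover, $\|E\|_2^2$ and $\|E\|_2^3$ are integrable, with $$\mathbf E\big[\|E\|_2^2\big]\le m_E^2+32\,\frac{\|M\|_\infty^2}{p^2}+8\,m_E\sqrt{\frac{2\pi\|M\|_\infty^2}{p^2}}$$ and $$\mathbf E\big[\|E\|_2^3\big]\le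 4\,m_E^3+12\sqrt{\pi}\,\Big(\frac{8\|M\|_\infty^2}{p^2}\Big)^{3/2}.$$ -/

import Mathlib

open MeasureTheory ProbabilityTheory

noncomputable section

namespace Subsampling

/-- The spectral norm `‖A‖₂` of a square real matrix: its operator norm for the Euclidean norm. -/
def specNorm {n : ℕ} (A : Matrix (Fin n) (Fin n) ℝ) : ℝ :=
  ‖Matrix.toEuclideanCLM (n := Fin n) (𝕜 := ℝ) A‖

/-- The entrywise maximum `‖A‖_∞ = max_{i,j} |A i j|` (equal to `0` for the empty matrix). -/
def maxNorm {n : ℕ} (A : Matrix (Fin n) (Fin n) ℝ) : ℝ :=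
  ⨆ ij : Fin n × Fin n, |A ij.1 ij.2|

/-- `C` is a symmetric random matrix whose entries on and below the diagonal are independent, each
taking the value `√((1-p)/p)` with probability `p` and `-√(p/(1-p))` with probability `1-p`. -/
structure IsSamplingMatrix {Ω : Type*} [MeasurableSpace Ω] (P : Measure Ω) {n : ℕ} (p : ℝ)
    (C : Ω → Matrix (Fin n) (Fin n) ℝ) : Prop where
  measurable_entry : ∀ i j, Measurable fun ω => C ω i j
  symm : ∀ᵐ ω ∂P, (C ω).IsSymm
  prob_high : ∀ i j, j ≤ i → P.real {ω | C ω i j = √((1 - p) / p)} = p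
  prob_low : ∀ i j, j ≤ i → P.real {ω | C ω i j = -√(p / (1 - p))} = 1 - p
  indep : iIndepFun
    (fun (ij : {ij : Fin n × Fin n // ij.2 ≤ ij.1}) (ω : Ω) => C ω ij.1.1 ij.1.2) P

/-- The error matrix `E = r_p M ∘ C`, with `r_p = √((1-p)/p)` and `∘` the entrywise product. -/
def errorMatrix {n : ℕ} (p : ℝ) (M C : Matrix (Fin n) (Fin n) ℝ) : Matrix (Fin n) (Fin n) ℝ :=
  √((1 - p) / p) • Matrix.hadamard M C

/-- `m` is a median of the real random variable `X`. -/
def IsMedian {Ω : Type*} [MeasurableSpace Ω] (P : Measure Ω) (X : Ω → ℝ) (m : ℝ) : Prop :=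
  1 / 2 ≤ P.real {ω | X ω ≤ m} ∧ 1 / 2 ≤ P.real {ω | m ≤ X ω}

end Subsampling

end

/-! Almost surely `E` is an affine function of independent bits, one per entry on or below the
diagonal, recording which entries of `C` are high. Hence `‖E‖₂` is a convex function `F` on the
biased cube. Flipping a bit moves an entry of `E` by `|M i j| / p`, each bit feeds at most two
entries, and the Frobenius norm dominates the spectral norm, so `F` has squared Lipschitz constant
`V = 2‖M‖_∞² / p²` (`errorNorm_lipschitz`).

The core is Talagrand's convex distance inequality `exists_projection`: for convex `K` meeting the
cube, the mean of `exp(d(x, K)² / 4)` times the mass of `K` is at most `1`. It goes by induction on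
the dimension. Let `u ≥ v` be the masses of the two facet sections. A point of the heavy facet uses
its own section; a point of the light facet uses a convex combination of points from both, with
weight chosen by `exists_interpolation`.

Applied to `K = {F ≤ a}`, Markov's inequality gives mass`{F ≤ a}` · mass`{F ≥ a + t}` ≤ `exp(-t² /
(4V))`. The levels `a = m` and `a = m - t` bound the two tails by `2 exp(-t² / (4V))` each, since
`m` is a median. The moments follow by integrating the tail. -/

namespace Subsampling

/-! ### The biased cube and its facets -/

/-- The point of the cube `{0,1}^N` encoded by a Boolean vector. -/
def cubePoint {N : ℕ} (x : Fin N → Bool) : Fin N → ℝ := fun i => if x i then 1 else 0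

/-- The mass of a point of the cube under the `N`-fold product of the weights `w`. -/
def cubeWeight (w : Bool → ℝ) {N : ℕ} (x : Fin N → Bool) : ℝ := ∏ i, w (x i)

lemma cubePoint_cons {N : ℕ} (b : Bool) (x : Fin N → Bool) :
    cubePoint (Fin.cons b x) = Fin.cons (if b then 1 else 0) (cubePoint x) := by
  funext i
  refine Fin.cases ?_ (fun j => ?_) i <;> simp [cubePoint]

lemma cubeWeight_cons (w : Bool → ℝ) {N : ℕ} (b : Bool) (x : Fin N → Bool) :
    cubeWeight w (Fin.cons b x) = w b * cubeWeight w x := by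
  simp [cubeWeight, Fin.prod_univ_succ]

lemma cubeWeight_nonneg {w : Bool → ℝ} (hw : ∀ b, 0 ≤ w b) {N : ℕ} (x : Fin N → Bool) :
    0 ≤ cubeWeight w x := Finset.prod_nonneg fun _ _ => hw _

lemma cubeWeight_pos {w : Bool → ℝ} (hw : ∀ b, 0 < w b) {N : ℕ} (x : Fin N → Bool) :
    0 < cubeWeight w x := Finset.prod_pos fun _ _ => hw _

lemma sum_cube_succ {N : ℕ} (f : (Fin (N + 1) → Bool) → ℝ) :
    ∑ x, f x = ∑ x, f (Fin.cons true x) + ∑ x, f (Fin.cons false x) := by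
  rw [← (Fin.consEquiv (fun _ : Fin (N + 1) => Bool)).sum_comp, Fintype.sum_prod_type]
  simp [Fin.consEquiv]

open Classical in
/-- The product measure of a subset of `ℝ^N`. -/
noncomputable def cubeMass (w : Bool → ℝ) {N : ℕ} (K : Set (Fin N → ℝ)) : ℝ :=
  ∑ x, if cubePoint x ∈ K then cubeWeight w x else 0

lemma cubeMass_nonneg {w : Bool → ℝ} (hw : ∀ b, 0 ≤ w b) {N : ℕ} (K : Set (Fin N → ℝ)) :
    0 ≤ cubeMass w K := Finset.sum_nonneg fun x _ => by
  split_ifs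
  exacts [cubeWeight_nonneg hw x, le_rfl]

lemma cubeMass_pos {w : Bool → ℝ} (hw : ∀ b, 0 < w b) {N : ℕ} {K : Set (Fin N → ℝ)}
    {x : Fin N → Bool} (hx : cubePoint x ∈ K) : 0 < cubeMass w K := by
  classical
  refine Finset.sum_pos' (fun y _ => ?_) ⟨x, Finset.mem_univ _, ?_⟩
  · split_ifs
    exacts [(cubeWeight_pos hw y).le, le_rfl]
  · rw [if_pos hx]; exact cubeWeight_pos hw x

lemma cubeMass_eq_zero (w : Bool → ℝ) {N : ℕ} {K : Set (Fin N → ℝ)}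
    (h : ¬ ∃ x, cubePoint x ∈ K) : cubeMass w K = 0 :=
  Finset.sum_eq_zero fun x _ => if_neg fun hx => h ⟨x, hx⟩

/-- The section of a subset of `ℝ^(N+1)` at a vertex value of the first coordinate. -/
def cubeSection {N : ℕ} (K : Set (Fin (N + 1) → ℝ)) (b : Bool) : Set (Fin N → ℝ) :=
  {y | (Fin.cons (if b then 1 else 0) y : Fin (N + 1) → ℝ) ∈ K}

lemma cubeMass_succ (w : Bool → ℝ) {N : ℕ} (K : Set (Fin (N + 1) → ℝ)) :
    cubeMass w K = w true * cubeMass w (cubeSection K true)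
      + w false * cubeMass w (cubeSection K false) := by
  classical
  rw [cubeMass, cubeMass, cubeMass, sum_cube_succ, Finset.mul_sum, Finset.mul_sum]
  congr 1 <;>
  · refine Finset.sum_congr rfl fun x _ => ?_
    rw [cubePoint_cons, cubeWeight_cons, mul_ite, mul_zero]
    rfl

lemma fin_cons_combo {N : ℕ} (α β a b : ℝ) (y z : Fin N → ℝ) :
    (α • (Fin.cons a y : Fin (N + 1) → ℝ) + β • (Fin.cons b z : Fin (N + 1) → ℝ))
      = Fin.cons (α * a + β * b) (α • y + β • z) := by
  funext i
  refine Fin.cases ?_ (fun j => ?_) i <;> simp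

lemma convex_cubeSection {N : ℕ} {K : Set (Fin (N + 1) → ℝ)} (hK : Convex ℝ K) (b : Bool) :
    Convex ℝ (cubeSection K b) := by
  intro y hy z hz α β hα hβ hαβ
  have h := hK hy hz hα hβ hαβ
  rw [fin_cons_combo, ← add_mul, hαβ, one_mul] at h
  exact h

/-! ### Talagrand's convex distance inequality -/

/-- Log-convexity of a weighted exponential sum. -/
lemma sum_mul_exp_combo_le {ι : Type*} [Fintype ι] (W f g : ι → ℝ) (hW : ∀ x, 0 ≤ W x)
    {θ a b : ℝ} (h0 : 0 ≤ θ) (h1 : θ ≤ 1)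
    (hf : ∑ x, W x * Real.exp (f x) ≤ Real.exp a) (hg : ∑ x, W x * Real.exp (g x) ≤ Real.exp b) :
    ∑ x, W x * Real.exp (θ * f x + (1 - θ) * g x) ≤ Real.exp (θ * a + (1 - θ) * b) := by
  -- Hölder's inequality by normalisation: after factoring out `exp a` and `exp b` both sums are at
  -- most `1`, and convexity of `exp` applies pointwise.
  have key : ∀ x, W x * Real.exp (θ * f x + (1 - θ) * g x)
      ≤ Real.exp (θ * a + (1 - θ) * b) *
        (θ * Real.exp (-a) * (W x * Real.exp (f x))
          + (1 - θ) * Real.exp (-b) * (W x * Real.exp (g x))) := by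
    intro x
    have hc := convexOn_exp.2 (Set.mem_univ (f x - a)) (Set.mem_univ (g x - b)) h0
      (sub_nonneg.2 h1) (by ring)
    simp only [smul_eq_mul] at hc
    have e1 : Real.exp (θ * f x + (1 - θ) * g x) = Real.exp (θ * a + (1 - θ) * b) *
        Real.exp (θ * (f x - a) + (1 - θ) * (g x - b)) := by
      rw [← Real.exp_add]; ring_nf
    rw [e1]
    calc _ = (W x * Real.exp (θ * a + (1 - θ) * b)) *
        Real.exp (θ * (f x - a) + (1 - θ) * (g x - b)) := by ring
      _ ≤ (W x * Real.exp (θ * a + (1 - θ) * b)) *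
        (θ * Real.exp (f x - a) + (1 - θ) * Real.exp (g x - b)) :=
          mul_le_mul_of_nonneg_left hc (mul_nonneg (hW x) (Real.exp_pos _).le)
      _ = _ := by
        simp only [sub_eq_add_neg (f x), sub_eq_add_neg (g x), Real.exp_add (f x), Real.exp_add (g x)]
        ring
  refine (Finset.sum_le_sum fun x _ => key x).trans ?_
  rw [← Finset.mul_sum, Finset.sum_add_distrib, ← Finset.mul_sum, ← Finset.mul_sum]
  have ha : θ * Real.exp (-a) * ∑ x, W x * Real.exp (f x) ≤ θ := by
    calc _ ≤ θ * Real.exp (-a) * Real.exp a :=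
          mul_le_mul_of_nonneg_left hf (mul_nonneg h0 (Real.exp_pos _).le)
      _ = θ := by rw [mul_assoc, ← Real.exp_add]; simp
  have hb : (1 - θ) * Real.exp (-b) * ∑ x, W x * Real.exp (g x) ≤ 1 - θ := by
    calc _ ≤ (1 - θ) * Real.exp (-b) * Real.exp b :=
          mul_le_mul_of_nonneg_left hg (mul_nonneg (sub_nonneg.2 h1) (Real.exp_pos _).le)
      _ = 1 - θ := by rw [mul_assoc, ← Real.exp_add]; simp
  calc _ ≤ Real.exp (θ * a + (1 - θ) * b) * 1 :=
        mul_le_mul_of_nonneg_left (by linarith) (Real.exp_pos _).le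
    _ = _ := mul_one _

/-- The exponents `s - s²` and `-s` have midpoint `-s²/2` and half-difference `s - s²/2`, so the two
exponentials sum to `2 exp(-s²/2) cosh(s - s²/2)`; then `cosh x ≤ exp(x²/2)` and `(s - s²/2)² ≤ s²`.
-/
lemma exp_sub_sq_le {s : ℝ} (h0 : 0 ≤ s) (h1 : s ≤ 1 / 2) :
    Real.exp (s - s ^ 2) ≤ 2 - Real.exp (-s) := by
  have e : Real.exp (s - s ^ 2) + Real.exp (-s)
      = Real.exp (-(s ^ 2 / 2)) * (2 * Real.cosh (s - s ^ 2 / 2)) := by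
    rw [Real.cosh_eq, mul_div_cancel₀ _ two_ne_zero, mul_add, ← Real.exp_add, ← Real.exp_add]
    ring_nf
  have hc := Real.cosh_le_exp_half_sq (s - s ^ 2 / 2)
  have h2 : Real.exp (-(s ^ 2 / 2)) * Real.exp ((s - s ^ 2 / 2) ^ 2 / 2) ≤ 1 := by
    rw [← Real.exp_add, Real.exp_le_one_iff]
    nlinarith [pow_nonneg h0 3, mul_nonneg (pow_nonneg h0 3) (sub_nonneg.2 h1)]
  nlinarith [Real.exp_pos (-(s ^ 2 / 2))]

lemma exp_quarter_le : Real.exp (1 / 4) ≤ 2 - Real.exp (-(1 / 2)) := by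
  have h := exp_sub_sq_le (s := 1 / 2) (by norm_num) le_rfl
  norm_num at h ⊢
  exact h

/-- The one-dimensional optimisation in the induction for the convex distance inequality. -/
lemma exists_interpolation {s : ℝ} (h0 : 0 ≤ s) :
    ∃ θ : ℝ, 0 ≤ θ ∧ θ ≤ 1 ∧
      Real.exp ((1 - θ) ^ 2 / 4 + θ * s) ≤ 2 - Real.exp (-s) := by
  rcases le_total s (1 / 2) with h | h
  -- The critical point of the exponent in `θ`, where its value is `s - s²`. It leaves `[0, 1]` once
  -- `s > 1/2`, and then the endpoint `θ = 0` suffices.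
  · refine ⟨1 - 2 * s, by linarith, by linarith, ?_⟩
    convert exp_sub_sq_le h0 h using 2
    ring
  · refine ⟨0, le_rfl, zero_le_one, ?_⟩
    have h1 := Real.exp_le_exp.2 (neg_le_neg h)
    have h2 := exp_quarter_le
    rw [show ((1 : ℝ) - 0) ^ 2 / 4 + 0 * s = 1 / 4 by ring]
    linarith

/-- The exponential of a quarter of the squared Euclidean distance. -/
noncomputable def expDist {N : ℕ} (y z : Fin N → ℝ) : ℝ := Real.exp ((∑ i, (y i - z i) ^ 2) / 4)

lemma expDist_cons {N : ℕ} (a b : ℝ) (y z : Fin N → ℝ) :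
    expDist (Fin.cons a y : Fin (N + 1) → ℝ) (Fin.cons b z)
      = Real.exp ((a - b) ^ 2 / 4) * expDist y z := by
  simp only [expDist, Fin.sum_univ_succ, Fin.cons_zero, Fin.cons_succ, add_div, Real.exp_add]

/-- Convexity of the squared distance; the defect in each coordinate is `θ(1 - θ)(y i - z i)²`. -/
lemma expDist_combo_le {N : ℕ} (x y z : Fin N → ℝ) {θ : ℝ} (h0 : 0 ≤ θ) (h1 : θ ≤ 1) :
    expDist x (θ • y + (1 - θ) • z)
      ≤ Real.exp (θ * ((∑ i, (x i - y i) ^ 2) / 4)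
          + (1 - θ) * ((∑ i, (x i - z i) ^ 2) / 4)) := by
  refine Real.exp_le_exp.2 ?_
  have : ∑ i, (x i - (θ • y + (1 - θ) • z) i) ^ 2
      ≤ ∑ i, (θ * (x i - y i) ^ 2 + (1 - θ) * (x i - z i) ^ 2) := by
    refine Finset.sum_le_sum fun i _ => ?_
    simp only [Pi.add_apply, Pi.smul_apply, smul_eq_mul]
    nlinarith [mul_nonneg (mul_nonneg h0 (sub_nonneg.2 h1)) (sq_nonneg (y i - z i))]
  rw [Finset.sum_add_distrib, ← Finset.mul_sum, ← Finset.mul_sum] at this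
  linarith

/-- Bound over the facet opposite to a facet whose section of `K` has the larger mass. -/
lemma exists_projection_opposite {w : Bool → ℝ} (hw : ∀ b, 0 < w b) {N : ℕ}
    {K : Set (Fin (N + 1) → ℝ)} (hK : Convex ℝ K) (b : Bool)
    (hle : cubeMass w (cubeSection K (!b)) ≤ cubeMass w (cubeSection K b))
    (hpos : 0 < cubeMass w (cubeSection K b))
    {g : (Fin N → Bool) → Fin N → ℝ} (hg : ∀ x, g x ∈ cubeSection K b)
    (hgs : (∑ x, cubeWeight w x * expDist (cubePoint x) (g x)) * cubeMass w (cubeSection K b) ≤ 1)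
    (hopp : (∃ x, cubePoint x ∈ cubeSection K (!b)) → ∃ g' : (Fin N → Bool) → Fin N → ℝ,
      (∀ x, g' x ∈ cubeSection K (!b)) ∧
      (∑ x, cubeWeight w x * expDist (cubePoint x) (g' x)) * cubeMass w (cubeSection K (!b)) ≤ 1) :
    ∃ h : (Fin N → Bool) → Fin (N + 1) → ℝ, (∀ x, h x ∈ K) ∧
      (∑ x, cubeWeight w x * expDist (cubePoint (Fin.cons (!b) x)) (h x))
        * cubeMass w (cubeSection K b) ^ 2
        ≤ 2 * cubeMass w (cubeSection K b) - cubeMass w (cubeSection K (!b)) := by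
  set u := cubeMass w (cubeSection K b)
  by_cases hne : ∃ x, cubePoint x ∈ cubeSection K (!b)
  · obtain ⟨g', hg', hgs'⟩ := hopp hne
    have hv : 0 < cubeMass w (cubeSection K (!b)) := cubeMass_pos hw hne.choose_spec
    set v := cubeMass w (cubeSection K (!b))
    -- Moving a fraction `1 - θ` of the way to the heavy facet costs `exp((1 - θ)²/4)`, and Hölder
    -- bounds the rest by `v^(-θ) u^(-(1 - θ)) = (u/v)^θ / u`. With `s = log(u/v)` the product is at
    -- most `(2 - v/u) / u`.
    obtain ⟨θ, h0, h1, hθ⟩ := exists_interpolation (s := Real.log u - Real.log v)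
      (sub_nonneg.2 (Real.log_le_log hv hle))
    have hsum := sum_mul_exp_combo_le (cubeWeight w)
      (fun x => (∑ i, (cubePoint x i - g' x i) ^ 2) / 4)
      (fun x => (∑ i, (cubePoint x i - g x i) ^ 2) / 4)
      (fun x => (cubeWeight_pos hw x).le) (a := -Real.log v) (b := -Real.log u) h0 h1
      (by rw [Real.exp_neg, Real.exp_log hv, ← one_div, le_div_iff₀ hv]; exact hgs')
      (by rw [Real.exp_neg, Real.exp_log hpos, ← one_div, le_div_iff₀ hpos]; exact hgs)
    refine ⟨fun x => θ • (Fin.cons (if (!b) then 1 else 0) (g' x) : Fin (N + 1) → ℝ)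
      + (1 - θ) • (Fin.cons (if b then 1 else 0) (g x) : Fin (N + 1) → ℝ),
      fun x => hK (hg' x) (hg x) h0 (sub_nonneg.2 h1) (by ring), ?_⟩
    have hpt : ∀ x, cubeWeight w x * expDist (cubePoint (Fin.cons (!b) x))
        (θ • (Fin.cons (if (!b) then 1 else 0) (g' x) : Fin (N + 1) → ℝ)
          + (1 - θ) • (Fin.cons (if b then 1 else 0) (g x) : Fin (N + 1) → ℝ))
        ≤ Real.exp ((1 - θ) ^ 2 / 4) * (cubeWeight w x *
          Real.exp (θ * ((∑ i, (cubePoint x i - g' x i) ^ 2) / 4)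
          + (1 - θ) * ((∑ i, (cubePoint x i - g x i) ^ 2) / 4))) := by
      intro x
      rw [fin_cons_combo, cubePoint_cons, expDist_cons]
      have e : ((if (!b) then (1 : ℝ) else 0) - (θ * (if (!b) then 1 else 0)
          + (1 - θ) * (if b then 1 else 0))) ^ 2 = (1 - θ) ^ 2 := by
        cases b <;> (simp; try ring)
      rw [e, mul_left_comm]
      exact mul_le_mul_of_nonneg_left (mul_le_mul_of_nonneg_left (expDist_combo_le _ _ _ h0 h1)
        (cubeWeight_pos hw x).le) (Real.exp_pos _).le
    have hS := Finset.sum_le_sum fun x (_ : x ∈ Finset.univ) => hpt x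
    rw [← Finset.mul_sum] at hS
    replace hS := hS.trans (mul_le_mul_of_nonneg_left hsum (Real.exp_pos _).le)
    have e2 : Real.exp ((1 - θ) ^ 2 / 4) *
        Real.exp (θ * -Real.log v + (1 - θ) * -Real.log u)
        = Real.exp ((1 - θ) ^ 2 / 4 + θ * (Real.log u - Real.log v)) / u := by
      have hu : Real.exp (Real.log u) = u := Real.exp_log hpos
      generalize Real.log u = l at hu
      rw [← hu, ← Real.exp_add, ← Real.exp_sub]; ring_nf
    have e3 : Real.exp (-(Real.log u - Real.log v)) = v / u := by
      rw [neg_sub, Real.exp_sub, Real.exp_log hv, Real.exp_log hpos]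
    rw [e2] at hS
    rw [e3] at hθ
    have := hS.trans (div_le_div_of_nonneg_right hθ hpos.le)
    calc _ ≤ ((2 - v / u) / u) * u ^ 2 := mul_le_mul_of_nonneg_right this (sq_nonneg u)
      _ = _ := by field_simp
  -- Here `v = 0`: crossing to the heavy facet costs the factor `exp(1/4) ≤ 2`.
  · rw [cubeMass_eq_zero w hne, sub_zero]
    refine ⟨fun x => Fin.cons (if b then 1 else 0) (g x), hg, ?_⟩
    have e : ((if (!b) then (1 : ℝ) else 0) - (if b then 1 else 0)) ^ 2 = 1 := by
      cases b <;> simp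
    simp only [cubePoint_cons, expDist_cons, e]
    have hS : ∑ x, cubeWeight w x * (Real.exp (1 / 4) * expDist (cubePoint x) (g x))
        = Real.exp (1 / 4) * ∑ x, cubeWeight w x * expDist (cubePoint x) (g x) := by
      rw [Finset.mul_sum]; exact Finset.sum_congr rfl fun x _ => by ring
    rw [hS]
    have h2 : Real.exp (1 / 4) ≤ 2 := exp_quarter_le.trans (by linarith [Real.exp_pos (-(1 / 2))])
    calc _ = Real.exp (1 / 4) * (((∑ x, cubeWeight w x * expDist (cubePoint x) (g x)) * u) * u) := by
          ring
      _ ≤ 2 * (1 * u) := by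
          refine mul_le_mul h2 (mul_le_mul_of_nonneg_right hgs hpos.le) ?_ zero_le_two
          refine mul_nonneg (mul_nonneg (Finset.sum_nonneg fun x _ => ?_) hpos.le) hpos.le
          exact mul_nonneg (cubeWeight_pos hw x).le (Real.exp_pos _).le
      _ = _ := by ring

/-- **Talagrand's convex distance inequality** on the discrete cube, with a choice of near points
in place of the distance. -/
theorem exists_projection {w : Bool → ℝ} (hw : ∀ b, 0 < w b) (hsum : w true + w false = 1) :
    ∀ {N : ℕ} {K : Set (Fin N → ℝ)}, Convex ℝ K → (∃ x, cubePoint x ∈ K) →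
      ∃ g : (Fin N → Bool) → Fin N → ℝ, (∀ x, g x ∈ K) ∧
        (∑ x, cubeWeight w x * expDist (cubePoint x) (g x)) * cubeMass w K ≤ 1 := by
  intro N
  induction N with
  | zero =>
    rintro K - ⟨x, hx⟩
    refine ⟨cubePoint, fun y => by rwa [Subsingleton.elim y x], ?_⟩
    simp only [cubeWeight, expDist, cubeMass, Fintype.sum_unique]
    simp only [Finset.univ_eq_empty, Finset.prod_empty, Finset.sum_empty, zero_div, Real.exp_zero,
      one_mul]
    split_ifs <;> norm_num
  | succ N ih =>
    intro K hK hne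
    obtain ⟨b, hle⟩ : ∃ b, cubeMass w (cubeSection K (!b)) ≤ cubeMass w (cubeSection K b) := by
      rcases le_total (cubeMass w (cubeSection K true)) (cubeMass w (cubeSection K false)) with h | h
      exacts [⟨false, h⟩, ⟨true, h⟩]
    have hmass : cubeMass w K = w b * cubeMass w (cubeSection K b)
        + w (!b) * cubeMass w (cubeSection K (!b)) := by
      rw [cubeMass_succ]; cases b
      · exact add_comm _ _
      · rfl
    have hwb : w b + w (!b) = 1 := by
      cases b
      · rw [add_comm]; exact hsum
      · exact hsum
    have hKpos : 0 < cubeMass w K := cubeMass_pos hw hne.choose_spec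
    have hpos : 0 < cubeMass w (cubeSection K b) := by
      by_contra hcon
      have h1 := mul_nonneg (hw b).le (sub_nonneg.2 hle)
      nlinarith [hw b, hw (!b)]
    have hneb : ∃ x, cubePoint x ∈ cubeSection K b := by
      by_contra hcon
      exact hpos.ne' (cubeMass_eq_zero w hcon)
    obtain ⟨g, hg, hgs⟩ := ih (convex_cubeSection hK b) hneb
    obtain ⟨h, hh, hhs⟩ := exists_projection_opposite hw hK b hle hpos hg hgs
      (ih (convex_cubeSection hK (!b)))
    refine ⟨fun x => if x 0 = b then Fin.cons (if b then 1 else 0) (g (Fin.tail x))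
      else h (Fin.tail x), fun x => ?_, ?_⟩
    · by_cases hx : x 0 = b
      · simp only [if_pos hx]; exact hg _
      · simp only [if_neg hx]; exact hh _
    have hsplit : ∀ f : (Fin (N + 1) → Bool) → ℝ,
        ∑ x, f x = ∑ x, f (Fin.cons b x) + ∑ x, f (Fin.cons (!b) x) := by
      intro f
      rw [sum_cube_succ]; cases b
      · exact add_comm _ _
      · rfl
    rw [hsplit]
    have hnb : (!b) ≠ b := by cases b <;> simp
    simp only [Fin.cons_zero, Fin.tail_cons, if_true, if_neg hnb, cubeWeight_cons, mul_assoc]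
    rw [← Finset.mul_sum, ← Finset.mul_sum]
    simp only [cubePoint_cons b, expDist_cons, sub_self]
    norm_num only [zero_div, Real.exp_zero, one_mul]
    rw [hmass]
    set u := cubeMass w (cubeSection K b)
    set v := cubeMass w (cubeSection K (!b))
    set S := ∑ x, cubeWeight w x * expDist (cubePoint x) (g x)
    set T := ∑ x, cubeWeight w x * expDist (cubePoint (Fin.cons (!b) x)) (h x)
    have hq := hw (!b)
    have hb := hw b
    set q := w (!b)
    have hbq : w b = 1 - q := by linarith
    rw [hbq] at hb hmass ⊢
    -- With `r = q(1 - v/u)`, the mean is at most `(1 + r)/u` while the mass of `K` is `u(1 - r)`,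
    -- so the product is at most `1 - r²`. Everything is multiplied by `u²` to avoid division.
    have hB : ((1 - q) * S + q * T) * u ^ 2 ≤ u + q * (u - v) := by
      have : S * u * u ≤ 1 * u := mul_le_mul_of_nonneg_right hgs hpos.le
      nlinarith
    have hM : 0 ≤ (1 - q) * u + q * v := by rw [← hmass]; exact hKpos.le
    have : (((1 - q) * S + q * T) * ((1 - q) * u + q * v)) * u ^ 2 ≤ 1 * u ^ 2 := by
      calc _ = (((1 - q) * S + q * T) * u ^ 2) * ((1 - q) * u + q * v) := by ring
        _ ≤ (u + q * (u - v)) * ((1 - q) * u + q * v) := mul_le_mul_of_nonneg_right hB hM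
        _ ≤ 1 * u ^ 2 := by nlinarith [sq_nonneg (q * (u - v))]
    exact le_of_mul_le_mul_right this (by positivity)

/-- Two-sided deviation of a convex Lipschitz function on the cube, before choosing levels. -/
theorem mass_mul_mass_le {w : Bool → ℝ} (hw : ∀ b, 0 < w b) (hsum : w true + w false = 1)
    {N : ℕ} {F : (Fin N → ℝ) → ℝ} (hF : ConvexOn ℝ Set.univ F) {V : ℝ} (hV : 0 < V)
    (hLip : ∀ y z, (F y - F z) ^ 2 ≤ V * ∑ i, (y i - z i) ^ 2) (a : ℝ) {t : ℝ} (ht : 0 ≤ t) :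
    cubeMass w {y | F y ≤ a} * cubeMass w {y | a + t ≤ F y} ≤ Real.exp (-(t ^ 2 / (4 * V))) := by
  classical
  by_cases hne : ∃ x : Fin N → Bool, cubePoint x ∈ {y | F y ≤ a}
  · have hK : Convex ℝ {y | F y ≤ a} := by simpa using hF.convex_le a
    obtain ⟨g, hg, hgs⟩ := exists_projection hw hsum hK hne
    have hA := cubeMass_pos hw hne.choose_spec
    -- Markov's inequality: where `F ≥ a + t`, the Lipschitz bound puts `x` at squared distance at
    -- least `t²/V` from `g x`.
    have hS : Real.exp (t ^ 2 / (4 * V)) * cubeMass w {y | a + t ≤ F y}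
        ≤ ∑ x, cubeWeight w x * expDist (cubePoint x) (g x) := by
      rw [cubeMass, Finset.mul_sum]
      refine Finset.sum_le_sum fun x _ => ?_
      split_ifs with hx
      · rw [mul_comm]
        refine mul_le_mul_of_nonneg_left (Real.exp_le_exp.2 ?_) (cubeWeight_pos hw x).le
        have h1 : t ≤ F (cubePoint x) - F (g x) := by
          have h2 : F (g x) ≤ a := hg x
          have h3 : a + t ≤ F (cubePoint x) := hx
          linarith
        have h2 : t ^ 2 ≤ V * ∑ i, (cubePoint x i - g x i) ^ 2 :=
          (pow_le_pow_left₀ ht h1 2).trans (hLip _ _)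
        rw [div_le_div_iff₀ (by positivity) (by norm_num)]
        linarith
      · rw [mul_zero]
        exact mul_nonneg (cubeWeight_pos hw x).le (Real.exp_pos _).le
    rw [Real.exp_neg, ← one_div, le_div_iff₀ (Real.exp_pos _)]
    calc _ = (Real.exp (t ^ 2 / (4 * V)) * cubeMass w {y | a + t ≤ F y})
          * cubeMass w {y | F y ≤ a} := by ring
      _ ≤ _ := (mul_le_mul_of_nonneg_right hS hA.le).trans hgs
  · rw [cubeMass_eq_zero w hne, zero_mul]
    exact (Real.exp_pos _).le

/-! ### Moments from a Gaussian tail -/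

/-- Moments of a nonnegative random variable with a Gaussian tail. -/
lemma integral_pow_le_of_tail {Ω : Type*} [MeasurableSpace Ω] {P : Measure Ω}
    [IsProbabilityMeasure P] {Y : Ω → ℝ} (hY : Measurable Y) (h0 : ∀ ω, 0 ≤ Y ω) {b : ℝ}
    (hb : 0 < b) (htail : ∀ t : ℝ, 0 ≤ t → P.real {ω | t < Y ω} ≤ 4 * Real.exp (-b * t ^ 2))
    {k : ℕ} (hk : 0 < k) :
    ∫ ω, Y ω ^ k ∂P ≤ 2 * k * (b ^ (-(k : ℝ) / 2) * Real.Gamma ((k : ℝ) / 2)) := by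
  have hk' : (0 : ℝ) < k := Nat.cast_pos.2 hk
  have hint := integral_rpow_mul_exp_neg_mul_rpow (p := 2) (q := (k : ℝ) - 1) two_pos
    (by linarith) hb
  have hintg := integrableOn_rpow_mul_exp_neg_mul_rpow (p := 2) (s := (k : ℝ) - 1) (b := b)
    (by linarith) two_pos hb
  rw [sub_add_cancel] at hint
  have hG : 0 ≤ b ^ (-(k : ℝ) / 2) * Real.Gamma ((k : ℝ) / 2) :=
    mul_nonneg (Real.rpow_nonneg hb.le _) (Real.Gamma_pos_of_pos (by positivity)).le
  rw [integral_eq_lintegral_of_nonneg_ae (ae_of_all _ fun ω => pow_nonneg (h0 ω) k)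
    (hY.pow_const k).aestronglyMeasurable]
  refine ENNReal.toReal_le_of_le_ofReal (by positivity) ?_
  simp_rw [← Real.rpow_natCast]
  rw [lintegral_rpow_eq_lintegral_meas_lt_mul P (ae_of_all _ h0) hY.aemeasurable hk']
  have hle : ∫⁻ t in Set.Ioi (0 : ℝ), P {a | t < Y a} * ENNReal.ofReal (t ^ ((k : ℝ) - 1))
      ≤ ∫⁻ t in Set.Ioi (0 : ℝ),
        ENNReal.ofReal (4 * (t ^ ((k : ℝ) - 1) * Real.exp (-b * t ^ (2 : ℝ)))) := by
    refine setLIntegral_mono' measurableSet_Ioi fun t ht => ?_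
    have ht' : (0 : ℝ) < t := ht
    rw [← ofReal_measureReal, ← ENNReal.ofReal_mul measureReal_nonneg]
    refine ENNReal.ofReal_le_ofReal ?_
    rw [Real.rpow_two]
    calc _ ≤ (4 * Real.exp (-b * t ^ 2)) * t ^ ((k : ℝ) - 1) :=
          mul_le_mul_of_nonneg_right (htail t ht'.le) (Real.rpow_nonneg ht'.le _)
      _ = _ := by ring
  rw [← ofReal_integral_eq_lintegral_ofReal (hintg.const_mul 4)
    ((ae_restrict_iff' measurableSet_Ioi).2 (ae_of_all _ fun t ht =>
      mul_nonneg (by norm_num) (mul_nonneg (Real.rpow_nonneg (le_of_lt ht) _)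
        (Real.exp_pos _).le))), integral_const_mul, hint] at hle
  refine (mul_le_mul_right hle _).trans ?_
  rw [← ENNReal.ofReal_mul hk'.le]
  exact ENNReal.ofReal_le_ofReal (le_of_eq (by ring))

lemma Gamma_three_halves : Real.Gamma (3 / 2) = √Real.pi / 2 := by
  rw [show (3 / 2 : ℝ) = 1 / 2 + 1 by norm_num, Real.Gamma_add_one (by norm_num),
    Real.Gamma_one_half_eq]
  ring

/-- Expand `X²` around `m`; the tail gives `E|X - m| ≤ 2√(πc)` and `E|X - m|² ≤ 4c`. -/
lemma second_moment_le_of_tail {Ω : Type*} [MeasurableSpace Ω] {P : Measure Ω}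
    [IsProbabilityMeasure P] {X : Ω → ℝ} (hX : Measurable X) (hbdd : ∃ B, ∀ ω, |X ω| ≤ B)
    {m : ℝ} (hm : 0 ≤ m) {c : ℝ} (hc : 0 < c)
    (htail : ∀ t : ℝ, 0 ≤ t → P.real {ω | t < |X ω - m|} ≤ 4 * Real.exp (-c⁻¹ * t ^ 2)) :
    ∫ ω, X ω ^ 2 ∂P ≤ m ^ 2 + 4 * c + 4 * m * √(Real.pi * c) := by
  obtain ⟨B, hB⟩ := hbdd
  have hY : Measurable fun ω => |X ω - m| := (hX.sub_const m).abs
  have hYb : ∀ ω, |X ω - m| ≤ B + m := fun ω => by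
    have := abs_sub (X ω) m
    rw [abs_of_nonneg hm] at this
    linarith [hB ω]
  have h1 := integral_pow_le_of_tail hY (fun ω => abs_nonneg _) (inv_pos.2 hc) htail one_pos
  have h2 := integral_pow_le_of_tail hY (fun ω => abs_nonneg _) (inv_pos.2 hc) htail two_pos
  have i1 : Integrable (fun ω => |X ω - m| ^ 1) P :=
    Integrable.of_bound (hY.pow_const 1).aestronglyMeasurable (B + m)
      (ae_of_all _ fun ω => by simpa using hYb ω)
  have i2 : Integrable (fun ω => |X ω - m| ^ 2) P :=
    Integrable.of_bound (hY.pow_const 2).aestronglyMeasurable ((B + m) ^ 2)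
      (ae_of_all _ fun ω => by
        rw [Real.norm_of_nonneg (by positivity)]
        exact pow_le_pow_left₀ (abs_nonneg _) (hYb ω) 2)
  have e1 : (c⁻¹ : ℝ) ^ (-((1 : ℕ) : ℝ) / 2) * Real.Gamma (((1 : ℕ) : ℝ) / 2) = √(Real.pi * c) := by
    rw [Real.inv_rpow hc.le, ← Real.rpow_neg hc.le, Nat.cast_one, neg_div, neg_neg,
      ← Real.sqrt_eq_rpow, Real.Gamma_one_half_eq, Real.sqrt_mul Real.pi_pos.le, mul_comm]
  have e2 : (c⁻¹ : ℝ) ^ (-((2 : ℕ) : ℝ) / 2) * Real.Gamma (((2 : ℕ) : ℝ) / 2) = c := by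
    rw [Real.inv_rpow hc.le, ← Real.rpow_neg hc.le]
    norm_num
  rw [e1] at h1
  rw [e2] at h2
  have hle : ∫ ω, X ω ^ 2 ∂P ≤ ∫ ω, (m ^ 2 + 2 * m * |X ω - m| ^ 1 + |X ω - m| ^ 2) ∂P := by
    refine integral_mono_of_nonneg (ae_of_all _ fun ω => sq_nonneg _)
      (((integrable_const _).add (i1.const_mul _)).add i2) (ae_of_all _ fun ω => ?_)
    simp only [pow_one, sq_abs]
    nlinarith [le_abs_self (X ω - m)]
  have i12 : Integrable (fun ω => m ^ 2 + 2 * m * |X ω - m| ^ 1) P :=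
    (integrable_const _).add (i1.const_mul _)
  rw [integral_add i12 i2, integral_add (integrable_const _) (i1.const_mul _), integral_const,
    integral_const_mul] at hle
  simp only [probReal_univ, one_smul] at hle
  push_cast at h1 h2
  nlinarith [mul_le_mul_of_nonneg_left h1 hm]

lemma third_moment_le_of_tail {Ω : Type*} [MeasurableSpace Ω] {P : Measure Ω}
    [IsProbabilityMeasure P] {X : Ω → ℝ} (hX : Measurable X) (hbdd : ∃ B, ∀ ω, |X ω| ≤ B)
    (hX0 : ∀ ω, 0 ≤ X ω) {m : ℝ} (hm : 0 ≤ m) {c : ℝ} (hc : 0 < c)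
    (htail : ∀ t : ℝ, 0 ≤ t → P.real {ω | t < |X ω - m|} ≤ 4 * Real.exp (-c⁻¹ * t ^ 2)) :
    ∫ ω, X ω ^ 3 ∂P ≤ 4 * m ^ 3 + 12 * √Real.pi * c ^ (3 / 2 : ℝ) := by
  obtain ⟨B, hB⟩ := hbdd
  have hY : Measurable fun ω => |X ω - m| := (hX.sub_const m).abs
  have hYb : ∀ ω, |X ω - m| ≤ B + m := fun ω => by
    have := abs_sub (X ω) m
    rw [abs_of_nonneg hm] at this
    linarith [hB ω]
  have h3 := integral_pow_le_of_tail hY (fun ω => abs_nonneg _) (inv_pos.2 hc) htail three_pos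
  have i3 : Integrable (fun ω => |X ω - m| ^ 3) P :=
    Integrable.of_bound (hY.pow_const 3).aestronglyMeasurable ((B + m) ^ 3)
      (ae_of_all _ fun ω => by
        rw [Real.norm_of_nonneg (by positivity)]
        exact pow_le_pow_left₀ (abs_nonneg _) (hYb ω) 3)
  have e3 : (c⁻¹ : ℝ) ^ (-((3 : ℕ) : ℝ) / 2) * Real.Gamma (((3 : ℕ) : ℝ) / 2)
      = c ^ (3 / 2 : ℝ) * (√Real.pi / 2) := by
    rw [Real.inv_rpow hc.le, ← Real.rpow_neg hc.le, neg_div, neg_neg, Nat.cast_ofNat,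
      Gamma_three_halves]
  rw [e3] at h3
  have hle : ∫ ω, X ω ^ 3 ∂P ≤ ∫ ω, (4 * m ^ 3 + 4 * |X ω - m| ^ 3) ∂P := by
    refine integral_mono_of_nonneg (ae_of_all _ fun ω => pow_nonneg (hX0 ω) 3)
      ((integrable_const _).add (i3.const_mul _)) (ae_of_all _ fun ω => ?_)
    have ha := abs_nonneg (X ω - m)
    have h1 : X ω ≤ m + |X ω - m| := by linarith [le_abs_self (X ω - m)]
    refine (pow_le_pow_left₀ (hX0 ω) h1 3).trans ?_
    -- With `y = |X - m|`, `4(m³ + y³) - (m + y)³ = 3(m + y)(m - y)²`.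
    nlinarith [mul_nonneg (add_nonneg hm ha) (sq_nonneg (m - |X ω - m|))]
  rw [integral_add (integrable_const _) (i3.const_mul _), integral_const, integral_const_mul] at hle
  simp only [probReal_univ, one_smul] at hle
  push_cast at h3
  linarith

/-! ### Spectral, Frobenius and maximum norms -/

lemma specNorm_nonneg {n : ℕ} (A : Matrix (Fin n) (Fin n) ℝ) : 0 ≤ specNorm A := norm_nonneg _

lemma specNorm_zero {n : ℕ} : specNorm (0 : Matrix (Fin n) (Fin n) ℝ) = 0 := by simp [specNorm]

lemma specNorm_add_le {n : ℕ} (A B : Matrix (Fin n) (Fin n) ℝ) :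
    specNorm (A + B) ≤ specNorm A + specNorm B := by
  simp only [specNorm, map_add]; exact norm_add_le _ _

lemma specNorm_smul {n : ℕ} {α : ℝ} (hα : 0 ≤ α) (A : Matrix (Fin n) (Fin n) ℝ) :
    specNorm (α • A) = α * specNorm A := by
  simp only [specNorm, map_smul, norm_smul, Real.norm_of_nonneg hα]

lemma abs_specNorm_sub_le {n : ℕ} (A B : Matrix (Fin n) (Fin n) ℝ) :
    |specNorm A - specNorm B| ≤ specNorm (A - B) := by
  simp only [specNorm, map_sub]; exact abs_norm_sub_norm_le _ _

/-- The spectral norm is at most the Frobenius norm. -/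
lemma specNorm_sq_le {n : ℕ} (A : Matrix (Fin n) (Fin n) ℝ) :
    specNorm A ^ 2 ≤ ∑ ij : Fin n × Fin n, A ij.1 ij.2 ^ 2 := by
  have h0 : 0 ≤ ∑ ij : Fin n × Fin n, A ij.1 ij.2 ^ 2 := Finset.sum_nonneg fun _ _ => sq_nonneg _
  refine (Real.le_sqrt (specNorm_nonneg A) h0).1 ?_
  refine ContinuousLinearMap.opNorm_le_bound _ (Real.sqrt_nonneg _) fun x => ?_
  rw [EuclideanSpace.norm_eq, EuclideanSpace.norm_eq, ← Real.sqrt_mul h0]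
  refine Real.sqrt_le_sqrt ?_
  rw [Fintype.sum_prod_type, Finset.sum_mul]
  refine Finset.sum_le_sum fun i _ => ?_
  simp only [Real.norm_eq_abs, sq_abs]
  have : (Matrix.toEuclideanCLM (n := Fin n) (𝕜 := ℝ) A x) i = ∑ j, A i j * x j := by
    rw [Matrix.ofLp_toEuclideanCLM]; rfl
  rw [this]
  exact Finset.sum_mul_sq_le_sq_mul_sq _ _ _

lemma abs_le_maxNorm {n : ℕ} (A : Matrix (Fin n) (Fin n) ℝ) (i j : Fin n) :
    |A i j| ≤ maxNorm A :=
  le_ciSup (f := fun ij : Fin n × Fin n => |A ij.1 ij.2|) (Set.finite_range _).bddAbove (i, j)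

lemma maxNorm_nonneg {n : ℕ} (A : Matrix (Fin n) (Fin n) ℝ) : 0 ≤ maxNorm A :=
  Real.iSup_nonneg fun _ => abs_nonneg _

/-! ### The error norm as a convex Lipschitz function of the bits -/

/-- The indices on and below the diagonal. -/
abbrev LowerIndex (n : ℕ) := {ij : Fin n × Fin n // ij.2 ≤ ij.1}

/-- The lower triangular index carrying the same entry of a symmetric matrix. -/
def lowerIndex {n : ℕ} (ij : Fin n × Fin n) : LowerIndex n :=
  ⟨(max ij.1 ij.2, min ij.1 ij.2), min_le_max⟩

/-- Only a position and its transpose can share a lower index, so fibres have at most two elements.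
This is the source of the factor `2` in the Lipschitz constant. -/
lemma sum_comp_lowerIndex_le {n : ℕ} (f : LowerIndex n → ℝ) (hf : ∀ k, 0 ≤ f k) :
    ∑ ij : Fin n × Fin n, f (lowerIndex ij) ≤ 2 * ∑ k, f k := by
  rw [← Finset.sum_fiberwise Finset.univ lowerIndex, Finset.mul_sum]
  refine Finset.sum_le_sum fun k _ => ?_
  rw [Finset.sum_congr rfl fun ij hij => by rw [(Finset.mem_filter.1 hij).2], Finset.sum_const,
    nsmul_eq_mul]
  refine mul_le_mul_of_nonneg_right ?_ (hf k)
  have hsub : (Finset.univ.filter fun ij : Fin n × Fin n => lowerIndex ij = k)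
      ⊆ {k.1, k.1.swap} := by
    intro ij hij
    have h := (Finset.mem_filter.1 hij).2
    rw [Finset.mem_insert, Finset.mem_singleton, ← h]
    rcases le_total ij.1 ij.2 with h | h
    · right; simp [lowerIndex, h]
    · left; simp [lowerIndex, h]
  exact_mod_cast (Finset.card_le_card hsub).trans Finset.card_le_two

/-- The symmetric matrix which interpolates affinely between the two values of the entries of a
sampling matrix. -/
noncomputable def interpMatrix {n N : ℕ} (p : ℝ) (e : LowerIndex n ≃ Fin N) (y : Fin N → ℝ) :
    Matrix (Fin n) (Fin n) ℝ := fun i j =>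
  -√(p / (1 - p)) + (√((1 - p) / p) + √(p / (1 - p))) * y (e (lowerIndex (i, j)))

/-- The jump of an entry of `r_p C` when its bit flips. -/
lemma value_gap {p : ℝ} (hp0 : 0 < p) (hp1 : p < 1) :
    √((1 - p) / p) * (√((1 - p) / p) + √(p / (1 - p))) = 1 / p := by
  have h1 : 0 < 1 - p := sub_pos.2 hp1
  rw [mul_add, Real.mul_self_sqrt (by positivity), ← Real.sqrt_mul (by positivity)]
  rw [show (1 - p) / p * (p / (1 - p)) = 1 by field_simp, Real.sqrt_one]
  field_simp
  ring

/-- The spectral norm of the error matrix as a function on the cube. -/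
noncomputable def errorNorm {n N : ℕ} (p : ℝ) (M : Matrix (Fin n) (Fin n) ℝ)
    (e : LowerIndex n ≃ Fin N) (y : Fin N → ℝ) : ℝ :=
  specNorm (errorMatrix p M (interpMatrix p e y))

lemma convexOn_errorNorm {n N : ℕ} (p : ℝ) (M : Matrix (Fin n) (Fin n) ℝ)
    (e : LowerIndex n ≃ Fin N) : ConvexOn ℝ Set.univ (errorNorm p M e) := by
  refine ⟨convex_univ, fun y _ z _ α β hα hβ hαβ => ?_⟩
  have h : errorMatrix p M (interpMatrix p e (α • y + β • z))
      = α • errorMatrix p M (interpMatrix p e y) + β • errorMatrix p M (interpMatrix p e z) := by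
    ext i j
    simp only [errorMatrix, interpMatrix, Matrix.add_apply, Matrix.smul_apply,
      Matrix.hadamard_apply, Pi.add_apply, Pi.smul_apply, smul_eq_mul]
    obtain rfl : β = 1 - α := by linarith
    ring
  rw [errorNorm, h]
  refine (specNorm_add_le _ _).trans ?_
  rw [specNorm_smul hα, specNorm_smul hβ]
  exact le_rfl

lemma errorNorm_lipschitz {n N : ℕ} {p : ℝ} (hp0 : 0 < p) (hp1 : p < 1)
    (M : Matrix (Fin n) (Fin n) ℝ) (e : LowerIndex n ≃ Fin N) (y z : Fin N → ℝ) :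
    (errorNorm p M e y - errorNorm p M e z) ^ 2
      ≤ (2 * (maxNorm M ^ 2 / p ^ 2)) * ∑ k, (y k - z k) ^ 2 := by
  have h1 := abs_specNorm_sub_le (errorMatrix p M (interpMatrix p e y))
    (errorMatrix p M (interpMatrix p e z))
  have h2 := pow_le_pow_left₀ (abs_nonneg _) h1 2
  rw [sq_abs] at h2
  refine (h2.trans (specNorm_sq_le _)).trans ?_
  have h3 : ∀ ij : Fin n × Fin n, ((errorMatrix p M (interpMatrix p e y)
      - errorMatrix p M (interpMatrix p e z)) ij.1 ij.2) ^ 2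
      ≤ maxNorm M ^ 2 / p ^ 2 * (y (e (lowerIndex ij)) - z (e (lowerIndex ij))) ^ 2 := by
    rintro ⟨i, j⟩
    have : (errorMatrix p M (interpMatrix p e y) - errorMatrix p M (interpMatrix p e z)) i j
        = (√((1 - p) / p) * (√((1 - p) / p) + √(p / (1 - p)))) * M i j
          * (y (e (lowerIndex (i, j))) - z (e (lowerIndex (i, j)))) := by
      simp only [errorMatrix, interpMatrix, Matrix.sub_apply, Matrix.smul_apply,
        Matrix.hadamard_apply, smul_eq_mul]
      ring
    rw [this, value_gap hp0 hp1, mul_pow]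
    refine mul_le_mul_of_nonneg_right ?_ (sq_nonneg _)
    rw [mul_pow, one_div, inv_pow, mul_comm, ← div_eq_mul_inv]
    refine div_le_div_of_nonneg_right ?_ (sq_nonneg p)
    rw [← sq_abs]
    exact pow_le_pow_left₀ (abs_nonneg _) (abs_le_maxNorm M i j) 2
  refine (Finset.sum_le_sum fun ij _ => h3 ij).trans ?_
  rw [← Finset.mul_sum]
  have h4 := sum_comp_lowerIndex_le (fun k => (y (e k) - z (e k)) ^ 2) fun k => sq_nonneg _
  rw [e.sum_comp fun k => (y k - z k) ^ 2] at h4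
  calc _ ≤ maxNorm M ^ 2 / p ^ 2 * (2 * ∑ k, (y k - z k) ^ 2) :=
        mul_le_mul_of_nonneg_left h4 (by positivity)
    _ = _ := by ring

/-! ### The law of the sampling pattern -/

/-- The mass function of a Bernoulli variable. -/
def bernoulliWeight (p : ℝ) (b : Bool) : ℝ := if b then p else 1 - p

/-- The Boolean vector recording which lower triangular entries take the high value. -/
noncomputable def pattern {Ω : Type*} {n N : ℕ} (p : ℝ) (C : Ω → Matrix (Fin n) (Fin n) ℝ)
    (e : LowerIndex n ≃ Fin N) (ω : Ω) (k : Fin N) : Bool :=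
  decide (C ω (e.symm k).1.1 (e.symm k).1.2 = √((1 - p) / p))

lemma measurable_decide_eq (a : ℝ) : Measurable fun c : ℝ => decide (c = a) := by
  refine measurable_to_bool ?_
  have h : (fun c : ℝ => decide (c = a)) ⁻¹' {true} = {a} := by ext c; simp
  rw [h]
  exact measurableSet_singleton a

section

variable {Ω : Type*} [MeasurableSpace Ω] {P : Measure Ω} {n N : ℕ} {p : ℝ}
  {C : Ω → Matrix (Fin n) (Fin n) ℝ}

lemma measurable_pattern (hC : IsSamplingMatrix P p C) (e : LowerIndex n ≃ Fin N) :
    Measurable (pattern p C e) :=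
  measurable_pi_lambda _ fun _ => (measurable_decide_eq _).comp (hC.measurable_entry _ _)

variable [IsProbabilityMeasure P]

lemma prob_pattern_eq (hC : IsSamplingMatrix P p C) (e : LowerIndex n ≃ Fin N)
    (x : Fin N → Bool) :
    P.real (pattern p C e ⁻¹' {x}) = cubeWeight (bernoulliWeight p) x := by
  have hind : iIndepFun (fun k ω => pattern p C e ω k) P :=
    (hC.indep.precomp e.symm.injective).comp (fun _ c => decide (c = √((1 - p) / p)))
      fun _ => measurable_decide_eq _
  have h := iIndepFun_iff_measure_inter_preimage_eq_mul.1 hind Finset.univ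
    (sets := fun k => {x k}) fun k _ => measurableSet_singleton _
  have hset : pattern p C e ⁻¹' {x}
      = ⋂ k ∈ Finset.univ, (fun ω => pattern p C e ω k) ⁻¹' {x k} := by
    ext ω
    simp [funext_iff]
  rw [hset, measureReal_def, h, ENNReal.toReal_prod, cubeWeight]
  refine Finset.prod_congr rfl fun k _ => ?_
  have hhigh := hC.prob_high _ _ (e.symm k).2
  rw [← measureReal_def]
  cases x k
  · have hs : (fun ω => pattern p C e ω k) ⁻¹' {false}
        = {ω | C ω (e.symm k).1.1 (e.symm k).1.2 = √((1 - p) / p)}ᶜ := by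
      ext ω; simp [pattern]
    rw [hs, probReal_compl_eq_one_sub
      (measurableSet_eq_fun (hC.measurable_entry _ _) measurable_const), hhigh]
    rfl
  · have hs : (fun ω => pattern p C e ω k) ⁻¹' {true}
        = {ω | C ω (e.symm k).1.1 (e.symm k).1.2 = √((1 - p) / p)} := by
      ext ω; simp [pattern]
    rw [hs, hhigh]
    rfl

lemma prob_cubePoint_pattern_mem (hC : IsSamplingMatrix P p C) (e : LowerIndex n ≃ Fin N)
    (K : Set (Fin N → ℝ)) :
    P.real {ω | cubePoint (pattern p C e ω) ∈ K} = cubeMass (bernoulliWeight p) K := by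
  classical
  rw [cubeMass, ← Finset.sum_filter]
  simp_rw [← prob_pattern_eq hC e]
  rw [sum_measureReal_preimage_singleton _
    fun x _ => measurable_pattern hC e (measurableSet_singleton x)]
  congr 1
  ext ω
  simp

/-- One value is positive and the other negative, so the two events are disjoint, and their
probabilities already add up to `1`. -/
lemma ae_entry_eq (hp0 : 0 < p) (hp1 : p < 1) (hC : IsSamplingMatrix P p C) (k : LowerIndex n) :
    ∀ᵐ ω ∂P, C ω k.1.1 k.1.2 = √((1 - p) / p) ∨ C ω k.1.1 k.1.2 = -√(p / (1 - p)) := by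
  have h1 : 0 < 1 - p := sub_pos.2 hp1
  have m1 : MeasurableSet {ω | C ω k.1.1 k.1.2 = √((1 - p) / p)} :=
    measurableSet_eq_fun (hC.measurable_entry _ _) measurable_const
  have m2 : MeasurableSet {ω | C ω k.1.1 k.1.2 = -√(p / (1 - p))} :=
    measurableSet_eq_fun (hC.measurable_entry _ _) measurable_const
  have hdis : Disjoint {ω | C ω k.1.1 k.1.2 = √((1 - p) / p)}
      {ω | C ω k.1.1 k.1.2 = -√(p / (1 - p))} := by
    refine Set.disjoint_left.2 fun ω ha hb => ?_
    have ha' : C ω k.1.1 k.1.2 = √((1 - p) / p) := ha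
    have hb' : C ω k.1.1 k.1.2 = -√(p / (1 - p)) := hb
    have q1 : 0 < √((1 - p) / p) := Real.sqrt_pos.2 (by positivity)
    have q2 : 0 < √(p / (1 - p)) := Real.sqrt_pos.2 (by positivity)
    linarith
  have hu := measureReal_union (μ := P) hdis m2
  rw [hC.prob_high _ _ k.2, hC.prob_low _ _ k.2, add_sub_cancel] at hu
  have hc := probReal_compl_eq_one_sub (μ := P) (m1.union m2)
  rw [hu, sub_self, measureReal_eq_zero_iff] at hc
  exact hc

/-- Almost surely, the sampling matrix is determined by the pattern of its high entries. -/
lemma ae_eq_interpMatrix (hp0 : 0 < p) (hp1 : p < 1) (hC : IsSamplingMatrix P p C)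
    (e : LowerIndex n ≃ Fin N) :
    ∀ᵐ ω ∂P, C ω = interpMatrix p e (cubePoint (pattern p C e ω)) := by
  filter_upwards [hC.symm, ae_all_iff.2 (ae_entry_eq hp0 hp1 hC)] with ω hs hω
  have key : ∀ k : LowerIndex n, C ω k.1.1 k.1.2 = -√(p / (1 - p))
      + (√((1 - p) / p) + √(p / (1 - p))) * cubePoint (pattern p C e ω) (e k) := by
    intro k
    simp only [cubePoint, pattern, Equiv.symm_apply_apply, decide_eq_true_eq]
    split_ifs with h
    · rw [h]; ring
    · rw [(hω k).resolve_left h]; ring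
  ext i j
  rw [interpMatrix, ← key (lowerIndex (i, j))]
  rcases le_total i j with h | h
  · simp only [lowerIndex, max_eq_right h, min_eq_left h]
    exact hs.apply j i
  · simp only [lowerIndex, max_eq_left h, min_eq_right h]

end

/-! ### Deviation about a median and the final assembly -/

/-- Concentration about a median of a convex Lipschitz function of independent Bernoulli
variables. -/
lemma cubeMass_deviation_le {w : Bool → ℝ} (hw : ∀ b, 0 < w b) (hsum : w true + w false = 1)
    {N : ℕ} {F : (Fin N → ℝ) → ℝ} (hF : ConvexOn ℝ Set.univ F) {V : ℝ} (hV : 0 < V)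
    (hLip : ∀ y z, (F y - F z) ^ 2 ≤ V * ∑ i, (y i - z i) ^ 2) {m : ℝ}
    (h1 : 1 / 2 ≤ cubeMass w {y | F y ≤ m}) (h2 : 1 / 2 ≤ cubeMass w {y | m ≤ F y})
    {t : ℝ} (ht : 0 ≤ t) :
    cubeMass w {y | t < |F y - m|} ≤ 4 * Real.exp (-(t ^ 2 / (4 * V))) := by
  have hup := mass_mul_mass_le hw hsum hF hV hLip m ht
  have hlow := mass_mul_mass_le hw hsum hF hV hLip (m - t) ht
  rw [sub_add_cancel] at hlow
  have hsplit : cubeMass w {y | t < |F y - m|}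
      ≤ cubeMass w {y | m + t ≤ F y} + cubeMass w {y | F y ≤ m - t} := by
    classical
    simp only [cubeMass]
    rw [← Finset.sum_add_distrib]
    refine Finset.sum_le_sum fun x _ => ?_
    have hx := (cubeWeight_pos hw x).le
    simp only [Set.mem_ofPred_eq]
    by_cases h : t < |F (cubePoint x) - m|
    · rw [if_pos h]
      rcases lt_abs.1 h with h' | h'
      · rw [if_pos (show m + t ≤ F (cubePoint x) by linarith)]
        split_ifs <;> linarith
      · rw [if_pos (show F (cubePoint x) ≤ m - t by linarith)]
        split_ifs <;> linarith
    · rw [if_neg h]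
      split_ifs <;> linarith
  have n1 := cubeMass_nonneg (fun b => (hw b).le) {y | m + t ≤ F y}
  have n2 := cubeMass_nonneg (fun b => (hw b).le) {y | F y ≤ m - t}
  nlinarith [mul_le_mul_of_nonneg_right h1 n1, mul_le_mul_of_nonneg_left h2 n2]

end Subsampling

open Subsampling

theorem mainTheorem6 {Ω : Type*} [MeasurableSpace Ω] (P : Measure Ω) [IsProbabilityMeasure P]
    {n : ℕ} (p : ℝ) (hp0 : 0 < p) (hp1 : p < 1)
    (M : Matrix (Fin n) (Fin n) ℝ)
    (C : Ω → Matrix (Fin n) (Fin n) ℝ) (hC : Subsampling.IsSamplingMatrix P p C)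
    (E : Ω → Matrix (Fin n) (Fin n) ℝ) (hE : ∀ ω, E ω = Subsampling.errorMatrix p M (C ω))
    (m : ℝ) (hm : Subsampling.IsMedian P (fun ω => Subsampling.specNorm (E ω)) m) :
    (∀ t : ℝ, 0 ≤ t →
      P.real {ω | t < |Subsampling.specNorm (E ω) - m|}
        ≤ 4 * Real.exp (-(p ^ 2 / (8 * Subsampling.maxNorm M ^ 2)) * t ^ 2)) ∧
    (Integrable (fun ω => Subsampling.specNorm (E ω) ^ 2) P ∧
      ∫ ω, Subsampling.specNorm (E ω) ^ 2 ∂P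
        ≤ m ^ 2 + 32 * (Subsampling.maxNorm M ^ 2 / p ^ 2)
          + 8 * m * √(2 * Real.pi * Subsampling.maxNorm M ^ 2 / p ^ 2)) ∧
    (Integrable (fun ω => Subsampling.specNorm (E ω) ^ 3) P ∧
      ∫ ω, Subsampling.specNorm (E ω) ^ 3 ∂P
        ≤ 4 * m ^ 3
          + 12 * √Real.pi * (8 * Subsampling.maxNorm M ^ 2 / p ^ 2) ^ (3 / 2 : ℝ)) := by
  have hm0 : 0 ≤ m := by
    by_contra hneg
    have hempty : {ω | specNorm (E ω) ≤ m} = ∅ :=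
      Set.eq_empty_of_forall_notMem fun ω hω =>
        hneg ((specNorm_nonneg (E ω)).trans hω)
    have h1 := hm.1
    rw [hempty, measureReal_empty] at h1
    norm_num at h1
  -- If `M = 0`, division by zero makes the exponent `0`, so the tail bound reads `4` and is
  -- trivial, as are the moment bounds.
  rcases (maxNorm_nonneg M).eq_or_lt with hM | hM
  · have hM0 : M = 0 := by
      ext i j
      have := abs_le_maxNorm M i j
      rw [← hM] at this
      exact abs_nonpos_iff.1 this
    have hE0 : ∀ ω, specNorm (E ω) = 0 := fun ω => by
      rw [hE, hM0, errorMatrix, Matrix.zero_hadamard, smul_zero, specNorm_zero]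
    simp only [hE0, ← hM]
    refine ⟨fun t _ => ?_, ⟨?_, ?_⟩, ?_, ?_⟩
    · norm_num
      linarith [measureReal_le_one (μ := P) (s := {ω : Ω | t < |m|})]
    · simp
    · norm_num
      positivity
    · simp
    · norm_num
      positivity
  obtain ⟨N, ⟨e⟩⟩ := Finite.exists_equiv_fin (LowerIndex n)
  set F := errorNorm p M e
  -- A version of `‖E‖₂` that is bounded and measurable everywhere, since it factors through the
  -- finite cube; `C` itself is symmetric and two-valued only almost surely.
  set X : Ω → ℝ := fun ω => F (cubePoint (pattern p C e ω))
  have hXE : ∀ᵐ ω ∂P, specNorm (E ω) = X ω := by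
    filter_upwards [ae_eq_interpMatrix hp0 hp1 hC e] with ω hω
    rw [hE]
    nth_rewrite 1 [hω]
    rfl
  have hXm : Measurable X :=
    (measurable_of_countable fun x : Fin N → Bool => F (cubePoint x)).comp
      (measurable_pattern hC e)
  have hX0 : ∀ ω, 0 ≤ X ω := fun ω => specNorm_nonneg _
  have hXb : ∃ B, ∀ ω, |X ω| ≤ B := by
    obtain ⟨B, hB⟩ := (Set.finite_range fun x : Fin N → Bool => |F (cubePoint x)|).bddAbove
    exact ⟨B, fun ω => hB ⟨pattern p C e ω, rfl⟩⟩
  have hlaw : ∀ S : Set ℝ, P.real {ω | specNorm (E ω) ∈ S}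
      = cubeMass (bernoulliWeight p) {y | F y ∈ S} := by
    intro S
    rw [← prob_cubePoint_pattern_mem hC e]
    refine measureReal_congr ?_
    filter_upwards [hXE] with ω hω
    exact congrArg (· ∈ S) hω
  have hw : ∀ b, 0 < bernoulliWeight p b := by
    rintro (_ | _)
    exacts [sub_pos.2 hp1, hp0]
  have hV : 0 < 2 * (maxNorm M ^ 2 / p ^ 2) := by positivity
  have htail : ∀ t : ℝ, 0 ≤ t → P.real {ω | t < |specNorm (E ω) - m|}
      ≤ 4 * Real.exp (-(p ^ 2 / (8 * maxNorm M ^ 2)) * t ^ 2) := by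
    intro t ht
    have h := cubeMass_deviation_le hw (by simp [bernoulliWeight]) (convexOn_errorNorm p M e) hV
      (errorNorm_lipschitz hp0 hp1 M e) (m := m)
      (hm.1.trans_eq (hlaw (Set.Iic m))) (hm.2.trans_eq (hlaw (Set.Ici m))) ht
    have hex : -(p ^ 2 / (8 * maxNorm M ^ 2)) * t ^ 2
        = -(t ^ 2 / (4 * (2 * (maxNorm M ^ 2 / p ^ 2)))) := by
      field_simp
      ring
    rw [hex]
    exact (hlaw {s | t < |s - m|}).trans_le h
  -- This is `4V`, so the tail takes the form `4 exp(-t²/c)`.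
  set c := 8 * maxNorm M ^ 2 / p ^ 2 with hc
  have hcpos : 0 < c := by positivity
  have htailX : ∀ t : ℝ, 0 ≤ t → P.real {ω | t < |X ω - m|} ≤ 4 * Real.exp (-c⁻¹ * t ^ 2) := by
    intro t ht
    rw [hc, inv_div]
    refine le_of_eq_of_le (measureReal_congr ?_) (htail t ht)
    filter_upwards [hXE] with ω hω
    exact congrArg (fun s => t < |s - m|) hω.symm
  have hint : ∀ k : ℕ, Integrable (fun ω => specNorm (E ω) ^ k) P := by
    intro k
    obtain ⟨B, hB⟩ := hXb
    have hi : Integrable (fun ω => X ω ^ k) P :=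
      Integrable.of_bound (hXm.pow_const k).aestronglyMeasurable (B ^ k) (ae_of_all _ fun ω => by
        rw [norm_pow]
        exact pow_le_pow_left₀ (norm_nonneg _) (hB ω) k)
    refine hi.congr ?_
    filter_upwards [hXE] with ω hω
    rw [hω]
  have heq : ∀ k : ℕ, ∫ ω, specNorm (E ω) ^ k ∂P = ∫ ω, X ω ^ k ∂P := by
    intro k
    refine integral_congr_ae ?_
    filter_upwards [hXE] with ω hω
    rw [hω]
  refine ⟨htail, ⟨hint 2, ?_⟩, hint 3, ?_⟩
  · rw [heq]
    refine (second_moment_le_of_tail hXm hXb hm0 hcpos htailX).trans (le_of_eq ?_)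
    have hs : √(Real.pi * c) = 2 * √(2 * Real.pi * maxNorm M ^ 2 / p ^ 2) := by
      rw [show Real.pi * c = 2 ^ 2 * (2 * Real.pi * maxNorm M ^ 2 / p ^ 2) by rw [hc]; ring,
        Real.sqrt_mul (by norm_num), Real.sqrt_sq (by norm_num)]
    rw [hs, hc]
    ring
  · rw [heq]
    exact third_moment_le_of_tail hXm hXb hX0 hm0 hcpos htailX
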